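/- For $P\in\mathbb{Z}[T]$ let $H(P)$ denote the maximum absolute value of its coefficients. For an integer $n\ge 1$ and $\zeta\in\mathbb{R}$, let $\widehat{w}_n(\zeta)\in[-\infty,\infty]$ be the supremum of the real numbers $w$ such that for all sufficiently large real $X$ the system $$H(P)\le X,\qquad 0<|P(\zeta)|\le X^{-w}$$ has a solution $P\in\mathbb{Z}[T]$ of degree at most $n$, and let $w_{=n}(\zeta)$ be the supremum of the real numbers $w$ such that for arbitrarily large real $X$ the same system has a solution $P\in\mathbb{Z}[T]$ that is irreducible and of degree exactly $n$. **Theorem.** Let $\zeta$ be a transcendental real number. Then $$w_{=3}(\zeta)\ \ge\ \widehat{w}_3(\zeta)\ \ge\ 3 .$$ Moreover, let $n\ge 4$ be an integer and suppose that the following holds: for every $\varepsilon>0$ there is a constant $c=c(n,\varepsilon)$ such that for every pair of coprime polynomials $P,Q\in\mathbb{Z}[T]$ of degree at most $n$, not both constant, there exist non-zero integers $a,b$ with $$\max\{|a|,|b|\}\le c\cdot\max\{H(P),H(Q)\}^{\varepsilon}$$ such that $aP+bQ$ is irreducible over $\mathbb{Q}$. Then $$w_{=n}(\zeta)\ \ge\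 \widehat{w}_n(\zeta)\ \ge\ n .$$ (Coprime means having no common factor in $\mathbb{Z}[T]$ other than $\pm 1$.) -/

import Mathlib

open Polynomial Filter

/-- `P` solves the system `H(P) ≤ X`, `0 < |P(ζ)| ≤ X ^ (-w)`, where the height
`H(P)` of an integer polynomial, the maximum absolute value of its coefficients, is `P.supNorm`. -/
def SolvesSystem (ζ w X : ℝ) (P : ℤ[X]) : Prop :=
  P.supNorm ≤ X ∧ 0 < |aeval ζ P| ∧ |aeval ζ P| ≤ X ^ (-w)

/-- The uniform exponent `ŵ_n(ζ)`: the supremum, in the extended reals, of the real `w` such that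
for all sufficiently large `X` the system has a solution of degree at most `n`. -/
noncomputable def uniformExponent (n : ℕ) (ζ : ℝ) : EReal :=
  sSup {e : EReal | ∃ w : ℝ, e = (w : EReal) ∧
    ∀ᶠ X : ℝ in atTop, ∃ P : ℤ[X], P.natDegree ≤ n ∧ SolvesSystem ζ w X P}

/-- The exponent `w_{=n}(ζ)` of approximation in exact degree: the supremum, in the extended reals,
of the real `w` such that for arbitrarily large `X` the system has an irreducible solution of
degree exactly `n`. -/
noncomputable def exactExponent (n : ℕ) (ζ : ℝ) : EReal :=
  sSup {e : EReal | ∃ w : ℝ, e = (w : EReal) ∧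
    ∃ᶠ X : ℝ in atTop, ∃ P : ℤ[X], P.natDegree = n ∧ Irreducible P ∧ SolvesSystem ζ w X P}

/-- The irreducibility criterion in degree `n`: for every `ε > 0` there is a constant `c`
(depending only on `n` and `ε`) such that all coprime integer polynomials `P`, `Q` of degree at
most `n`, not both constant, admit nonzero integers `a`, `b` of absolute value at most
`c * max (H(P), H(Q)) ^ ε` for which `a P + b Q` is irreducible over `ℚ`. -/
def IrreducibilityCriterion (n : ℕ) : Prop :=
  ∀ ε : ℝ, 0 < ε → ∃ c : ℝ, ∀ P Q : ℤ[X],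
    P.natDegree ≤ n → Q.natDegree ≤ n → (P.natDegree ≠ 0 ∨ Q.natDegree ≠ 0) → IsRelPrime P Q →
    ∃ a b : ℤ, a ≠ 0 ∧ b ≠ 0 ∧
      ((max |a| |b| : ℤ) : ℝ) ≤ c * (max P.supNorm Q.supNorm) ^ ε ∧
      Irreducible ((C a * P + C b * Q).map (Int.castRingHom ℚ))

/-! The bound `n ≤ ŵ_n` is Dirichlet's pigeonhole argument. For `ŵ_n ≤ w_{=n}`, fix `v < u < w <
ŵ_n`. Since Mahler measure is multiplicative, small values of arbitrary polynomials force small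
values of irreducible ones: there are irreducible `R` of degree at most `n`, with `M(R)` arbitrarily
large, such that `|R(ζ)| ≤ M(R)^(-u)`.

If `deg R = n`, then `R` itself serves. Otherwise uniformity supplies a `P` small at `ζ`, of height
a small constant times `M(R)`. Then `M(P) < M(R)`, so `R` cannot divide `P`. Raise `P` to degree
`n`, keeping it prime to `R`. A combination `A * R + B * P` with coefficients of size `H^ε` is still
small at `ζ`, so it is enough to make it irreducible of degree `n`; this is
`HasIrreducibleCombinations`.

For `n ≥ 4` the criterion provides constants `A`, `B`. For `n = 3` take `B = 1` and work modulo a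
prime `p ≪ H^ε` at which `R` and `P` stay coprime. A cubic over a field is irreducible once it has
no root, and counting incidences between lines and the graph of `-P/R` over `𝔽_p` yields a suitable
`A`. -/

/-! ### Mahler measure of integer polynomials -/

/-- The Mahler measure of an integer polynomial. -/
noncomputable def intMahler (P : ℤ[X]) : ℝ := (P.map (Int.castRingHom ℂ)).mahlerMeasure

theorem supNorm_map_intCast (P : ℤ[X]) :
    (P.map (Int.castRingHom ℂ)).supNorm = P.supNorm := by
  simp [supNorm_eq_iSup, Int.norm_eq_abs]

theorem intMahler_mul (P Q : ℤ[X]) : intMahler (P * Q) = intMahler P * intMahler Q := by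
  simp [intMahler, mahlerMeasure_mul]

theorem one_le_intMahler {P : ℤ[X]} (hP : P ≠ 0) : 1 ≤ intMahler P :=
  one_le_mahlerMeasure_of_ne_zero hP

theorem intMahler_le_supNorm {P : ℤ[X]} {n : ℕ} (hP : P.natDegree ≤ n) :
    intMahler P ≤ (n + 1) * P.supNorm := by
  have h := (P.map (Int.castRingHom ℂ)).mahlerMeasure_le_sqrt_natDegree_add_one_mul_supNorm
  rw [supNorm_map_intCast, natDegree_map_eq_of_injective (Int.castRingHom ℂ).injective_int] at h
  have h0 := P.supNorm_nonneg
  have hn : (P.natDegree : ℝ) ≤ n := by exact_mod_cast hP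
  refine h.trans (mul_le_mul_of_nonneg_right ?_ h0)
  refine (Real.sqrt_le_iff.2 ⟨by positivity, ?_⟩)
  nlinarith [(Nat.cast_nonneg P.natDegree : (0 : ℝ) ≤ _)]

theorem supNorm_le_intMahler {P : ℤ[X]} {n : ℕ} (hP : P.natDegree ≤ n) :
    P.supNorm ≤ 2 ^ n * intMahler P := by
  have h := (P.map (Int.castRingHom ℂ)).supNorm_le_choose_natDegree_div_two_mul_mahlerMeasure
  rw [supNorm_map_intCast, natDegree_map_eq_of_injective (Int.castRingHom ℂ).injective_int] at h
  refine h.trans (mul_le_mul_of_nonneg_right ?_ (mahlerMeasure_nonneg _))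
  calc ((P.natDegree.choose (P.natDegree / 2) : ℕ) : ℝ) ≤ 2 ^ P.natDegree := by
        exact_mod_cast Nat.choose_le_two_pow _ _
    _ ≤ 2 ^ n := pow_le_pow_right₀ (by norm_num) hP

theorem intMahler_le_of_dvd {P Q : ℤ[X]} (h : P ∣ Q) (hQ : Q ≠ 0) :
    intMahler P ≤ intMahler Q := by
  obtain ⟨S, rfl⟩ := h
  rw [intMahler_mul]
  exact le_mul_of_one_le_right (mahlerMeasure_nonneg _)
    (one_le_intMahler (right_ne_zero_of_mul hQ))

/-! ### Basic estimates on the sup norm -/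

theorem supNorm_le_iff {P : ℤ[X]} {B : ℝ} : P.supNorm ≤ B ↔ ∀ i, |(P.coeff i : ℝ)| ≤ B := by
  constructor
  · intro h i
    refine le_trans ?_ h
    simpa [Int.norm_eq_abs] using P.le_supNorm i
  · intro h
    obtain ⟨i, hi⟩ := P.exists_eq_supNorm
    rw [hi]
    simpa [Int.norm_eq_abs] using h i

theorem supNorm_add_le (P Q : ℤ[X]) : (P + Q).supNorm ≤ P.supNorm + Q.supNorm := by
  rw [supNorm_le_iff]
  intro i
  have h1 := supNorm_le_iff.1 (le_refl P.supNorm) i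
  have h2 := supNorm_le_iff.1 (le_refl Q.supNorm) i
  rw [coeff_add]
  push_cast
  exact (abs_add_le _ _).trans (add_le_add h1 h2)

theorem supNorm_mul_le {P : ℤ[X]} {n : ℕ} (hP : P.natDegree ≤ n) (Q : ℤ[X]) :
    (P * Q).supNorm ≤ (n + 1) * (P.supNorm * Q.supNorm) := by
  rw [supNorm_le_iff]
  intro i
  rw [coeff_mul, Finset.Nat.sum_antidiagonal_eq_sum_range_succ_mk]
  push_cast
  have key : ∀ k ∈ Finset.range (i + 1), |(P.coeff k : ℝ) * (Q.coeff (i - k) : ℝ)| ≤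
      if k ∈ Finset.range (n + 1) then P.supNorm * Q.supNorm else 0 := by
    intro k _
    split_ifs with hk
    · rw [abs_mul]
      exact mul_le_mul (supNorm_le_iff.1 le_rfl k) (supNorm_le_iff.1 le_rfl _) (abs_nonneg _)
        P.supNorm_nonneg
    · rw [coeff_eq_zero_of_natDegree_lt (by simp at hk; omega)]
      simp
  refine (Finset.abs_sum_le_sum_abs _ _).trans ((Finset.sum_le_sum key).trans ?_)
  rw [← Finset.sum_filter]
  rw [Finset.sum_const, nsmul_eq_mul]
  have h0 := mul_nonneg P.supNorm_nonneg Q.supNorm_nonneg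
  refine mul_le_mul_of_nonneg_right ?_ h0
  have : (Finset.filter (· ∈ Finset.range (n + 1)) (Finset.range (i + 1))).card ≤ n + 1 := by
    calc _ ≤ (Finset.range (n + 1)).card := Finset.card_le_card (fun x hx => (Finset.mem_filter.1 hx).2)
      _ = n + 1 := Finset.card_range _
  exact_mod_cast this

theorem abs_aeval_le {P : ℤ[X]} {n : ℕ} (hP : P.natDegree ≤ n) (ζ : ℝ) :
    |aeval ζ P| ≤ (∑ i ∈ Finset.range (n + 1), |ζ| ^ i) * P.supNorm := by
  rw [aeval_eq_sum_range' (Nat.lt_succ_of_le hP), Finset.sum_mul]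
  refine (Finset.abs_sum_le_sum_abs _ _).trans (Finset.sum_le_sum fun i _ => ?_)
  rw [zsmul_eq_mul, abs_mul, abs_pow, mul_comm]
  exact mul_le_mul_of_nonneg_left (supNorm_le_iff.1 le_rfl i) (by positivity)

theorem aeval_ne_zero_of_transcendental {ζ : ℝ} (hζ : Transcendental ℚ ζ) {P : ℤ[X]}
    (hP : P ≠ 0) : aeval ζ P ≠ 0 := by
  intro h
  refine hζ ⟨P.map (Int.castRingHom ℚ), ?_, ?_⟩
  · rwa [Ne, Polynomial.map_eq_zero_iff (Int.castRingHom ℚ).injective_int]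
  · rw [← h, ← algebraMap_int_eq, aeval_map_algebraMap]

theorem supNorm_primPart_le {P : ℤ[X]} (hP : P ≠ 0) :
    P.primPart.supNorm ≤ P.supNorm := by
  rw [supNorm_le_iff]
  intro i
  refine le_trans ?_ (supNorm_le_iff.1 (le_refl P.supNorm) i)
  conv_rhs => rw [P.eq_C_content_mul_primPart, coeff_C_mul]
  push_cast
  rw [abs_mul]
  refine le_mul_of_one_le_left (abs_nonneg _) ?_
  exact_mod_cast Int.one_le_abs (mt content_eq_zero_iff.1 hP)

theorem abs_aeval_primPart_le {P : ℤ[X]} (hP : P ≠ 0) (ζ : ℝ) :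
    |aeval ζ P.primPart| ≤ |aeval ζ P| := by
  conv_rhs => rw [P.eq_C_content_mul_primPart, map_mul, abs_mul, aeval_C]
  refine le_mul_of_one_le_left (abs_nonneg _) ?_
  rw [eq_intCast]
  exact_mod_cast Int.one_le_abs (mt content_eq_zero_iff.1 hP)

/-! ### Dirichlet's theorem for integer polynomials -/

/-- Pigeonhole on the `(N+1)^(n+1)` polynomials with coefficients in `[0, N]`: their values at `ζ`
are sorted into intervals of length `δ`. The `+ 2` pays for the two floors. -/
theorem exists_small_value (n N : ℕ) (ζ δ : ℝ) (hδ : 0 < δ)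
    (h : 2 * ((∑ i ∈ Finset.range (n + 1), |ζ| ^ i) * N) / δ + 2 < ((N : ℝ) + 1) ^ (n + 1)) :
    ∃ P : ℤ[X], P ≠ 0 ∧ P.natDegree ≤ n ∧ P.supNorm ≤ N ∧ |aeval ζ P| ≤ δ := by
  set S := (∑ i ∈ Finset.range (n + 1), |ζ| ^ i) * (N : ℝ) with hS
  have hS0 : 0 ≤ S := by positivity
  let p : (Fin (n + 1) → Fin (N + 1)) → ℤ[X] := fun c => ∑ i, monomial i.1 ((c i : ℕ) : ℤ)
  have hcoeff (c : Fin (n + 1) → Fin (N + 1)) (i : Fin (n + 1)) :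
      (p c).coeff i.1 = ((c i : ℕ) : ℤ) := by
    simp only [p, finsetSum_coeff, coeff_monomial]
    rw [Finset.sum_eq_single i (fun j _ hj => if_neg fun h => hj (Fin.ext h)) (by simp)]
    exact if_pos rfl
  have hdeg (c) : (p c).natDegree ≤ n :=
    natDegree_sum_le_of_forall_le _ _ fun i _ => (natDegree_monomial_le _).trans (by omega)
  have hbig (c : Fin (n + 1) → Fin (N + 1)) (i : ℕ) : (p c).coeff i ∈ Set.Icc (0 : ℤ) N := by
    by_cases hi : i < n + 1
    · have := hcoeff c ⟨i, hi⟩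
      simp only at this
      rw [this]
      constructor
      · positivity
      · have := (c ⟨i, hi⟩).2
        exact_mod_cast Nat.lt_succ_iff.1 this
    · rw [coeff_eq_zero_of_natDegree_lt (by have := hdeg c; omega)]
      simp
  have hval (c) : |aeval ζ (p c)| ≤ S := by
    refine (abs_aeval_le (hdeg c) ζ).trans (mul_le_mul_of_nonneg_left ?_ (by positivity))
    rw [supNorm_le_iff]
    intro i
    obtain ⟨h0, h1⟩ := hbig c i
    rw [abs_of_nonneg (by exact_mod_cast h0)]
    exact_mod_cast h1
  have hcard : (Finset.Icc ⌊-S / δ⌋ ⌊S / δ⌋).card <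
      (Finset.univ : Finset (Fin (n + 1) → Fin (N + 1))).card := by
    rw [Int.card_Icc, Finset.card_univ, Fintype.card_pi]
    simp only [Fintype.card_fin, Finset.prod_const, Finset.card_univ]
    have hle : ⌊-S / δ⌋ ≤ ⌊S / δ⌋ := Int.floor_le_floor (by gcongr; linarith)
    zify
    rw [Int.toNat_of_nonneg (by omega)]
    have h1 := Int.floor_le (S / δ)
    have h2 := Int.lt_floor_add_one (-S / δ)
    have h3 : ((⌊S / δ⌋ + 1 - ⌊-S / δ⌋ : ℤ) : ℝ) < ((N : ℝ) + 1) ^ (n + 1) := by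
      push_cast
      refine lt_of_lt_of_le ?_ h.le
      have : 2 * S / δ = S / δ - -S / δ := by ring
      linarith
    exact_mod_cast h3
  obtain ⟨c, -, d, -, hcd, hf⟩ := Finset.exists_ne_map_eq_of_card_lt_of_maps_to hcard
    (f := fun c => ⌊aeval ζ (p c) / δ⌋) (fun c _ => by
      have := abs_le.1 (hval c)
      simp only [Finset.coe_Icc, Set.mem_Icc]
      exact ⟨Int.floor_le_floor (by gcongr; exact this.1),
        Int.floor_le_floor (by gcongr; exact this.2)⟩)
  refine ⟨p c - p d, fun h0 => hcd ?_, (natDegree_sub_le _ _).trans (max_le (hdeg c) (hdeg d)),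
    ?_, ?_⟩
  · funext i
    have := hcoeff c i
    rw [sub_eq_zero.1 h0, hcoeff d i] at this
    exact Fin.ext (by exact_mod_cast this.symm)
  · rw [supNorm_le_iff]
    intro i
    have h1 := hbig c i
    have h2 := hbig d i
    rw [coeff_sub]
    have : |(p c).coeff i - (p d).coeff i| ≤ (N : ℤ) := by
      rw [abs_le]
      constructor <;> linarith [h1.1, h1.2, h2.1, h2.2]
    exact_mod_cast this
  · have h1 := Int.abs_sub_lt_one_of_floor_eq_floor hf
    rw [← sub_div, abs_div, abs_of_pos hδ, div_lt_one hδ] at h1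
    rw [map_sub]
    exact h1.le

theorem eventually_exists_solvesSystem {ζ : ℝ} (hζ : Transcendental ℚ ζ) {n : ℕ} {w : ℝ}
    (hw : w < n) : ∀ᶠ X : ℝ in atTop, ∃ P : ℤ[X], P.natDegree ≤ n ∧ SolvesSystem ζ w X P := by
  set S := ∑ i ∈ Finset.range (n + 1), |ζ| ^ i with hS
  have hS0 : 0 ≤ S := by positivity
  -- The pigeonhole inequality for `N = ⌊X⌋`, `δ = X^(-w)`, divided by `X^(n+1)`.
  have h1 : Tendsto (fun X : ℝ => 2 * S * X ^ (-((n : ℝ) - w)) + 2 * X ^ (-((n : ℝ) + 1))) atTop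
      (nhds (2 * S * 0 + 2 * 0)) :=
    ((tendsto_rpow_neg_atTop (by linarith)).const_mul _).add
      ((tendsto_rpow_neg_atTop (by positivity)).const_mul _)
  have h2 := h1.eventually (gt_mem_nhds (show 2 * S * 0 + 2 * 0 < (1 : ℝ) by norm_num))
  filter_upwards [h2, eventually_gt_atTop 0] with X hX hX0
  have hN := Nat.lt_floor_add_one X
  have hN' := Nat.floor_le hX0.le
  obtain ⟨P, hP, hdeg, hH, hv⟩ := exists_small_value n ⌊X⌋₊ ζ (X ^ (-w)) (by positivity) (by
    have hp : 0 < X ^ ((n : ℝ) + 1) := by positivity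
    have h3 := mul_lt_mul_of_pos_right hX hp
    rw [add_mul, one_mul, mul_assoc (2 * S), ← Real.rpow_add hX0, mul_assoc 2 (X ^ _),
      ← Real.rpow_add hX0, neg_add_cancel, Real.rpow_zero, mul_one] at h3
    calc 2 * (S * ⌊X⌋₊) / X ^ (-w) + 2 ≤ 2 * (S * X) / X ^ (-w) + 2 := by gcongr
      _ = 2 * S * X ^ (-((n : ℝ) - w) + (n + 1)) + 2 := by
        rw [show -((n : ℝ) - w) + (n + 1) = 1 - -w by ring, Real.rpow_sub hX0, Real.rpow_one]
        ring
      _ < X ^ ((n : ℝ) + 1) := h3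
      _ ≤ ((⌊X⌋₊ : ℝ) + 1) ^ ((n : ℝ) + 1) := by gcongr
      _ = ((⌊X⌋₊ : ℝ) + 1) ^ (n + 1) := by
        rw [← Real.rpow_natCast]
        push_cast
        rfl)
  exact ⟨P, hdeg, hH.trans hN', abs_pos.2 (aeval_ne_zero_of_transcendental hζ hP), hv⟩

theorem natCast_le_uniformExponent {ζ : ℝ} (hζ : Transcendental ℚ ζ) (n : ℕ) :
    (n : EReal) ≤ uniformExponent n ζ := by
  refine le_of_forall_lt fun c hc => ?_
  obtain ⟨w, hcw, hwn⟩ := EReal.lt_iff_exists_real_btwn.1 hc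
  refine hcw.trans_le (le_sSup ⟨w, rfl, eventually_exists_solvesSystem hζ ?_⟩)
  exact_mod_cast hwn

theorem eventually_of_lt_uniformExponent {ζ v : ℝ} {n : ℕ}
    (hv : (v : EReal) < uniformExponent n ζ) :
    ∀ᶠ X : ℝ in atTop, ∃ P : ℤ[X], P.natDegree ≤ n ∧ SolvesSystem ζ v X P := by
  obtain ⟨_, ⟨w, rfl, hw⟩, hvw⟩ := lt_sSup_iff.1 hv
  filter_upwards [hw, eventually_ge_atTop 1] with X ⟨P, hdeg, hH, h0, h1⟩ hX
  refine ⟨P, hdeg, hH, h0, h1.trans (Real.rpow_le_rpow_of_exponent_le hX ?_)⟩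
  have : v < w := by exact_mod_cast hvw
  linarith

/-! ### Irreducible polynomials with small values -/

/-- Multiply the bounds over the irreducible factors of `P`. Each nonconstant factor costs one `δ`,
and there are at most `deg P` of them; an irreducible constant has absolute value at least 1 and
costs nothing. -/
theorem pow_mul_rpow_intMahler_le_abs_aeval {ζ v δ : ℝ} {n : ℕ} (hv : 0 < v) (hδ0 : 0 ≤ δ)
    (hδ1 : δ ≤ 1)
    (h : ∀ R : ℤ[X], Irreducible R → 1 ≤ R.natDegree → R.natDegree ≤ n →
      δ * intMahler R ^ (-v) ≤ |aeval ζ R|) (P : ℤ[X]) (hP : P ≠ 0) (hPn : P.natDegree ≤ n) :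
    δ ^ P.natDegree * intMahler P ^ (-v) ≤ |aeval ζ P| := by
  induction P using WfDvdMonoid.induction_on_irreducible with
  | zero => exact absurd rfl hP
  | unit u hu =>
    obtain ⟨a, ha, rfl⟩ := isUnit_iff.1 hu
    have := Int.isUnit_iff_abs_eq.1 ha
    have h1 : |(a : ℝ)| = 1 := by exact_mod_cast this
    have h2 := Real.rpow_le_one_of_one_le_of_nonpos (one_le_intMahler hP) (neg_nonpos.2 hv.le)
    simpa [h1] using h2
  | mul Q R hQ hR ih =>
    have hdeg := natDegree_mul hR.ne_zero hQ
    rw [hdeg] at hPn ⊢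
    have hM (S : ℤ[X]) : 0 ≤ intMahler S := mahlerMeasure_nonneg _
    rw [intMahler_mul, Real.mul_rpow (hM _) (hM _), map_mul,
      abs_mul, pow_add, mul_mul_mul_comm]
    refine mul_le_mul ?_ (ih hQ (by omega)) (mul_nonneg (by positivity) (Real.rpow_nonneg (hM _) _))
      (abs_nonneg _)
    rcases Nat.eq_zero_or_pos R.natDegree with h0 | h0
    · obtain ⟨a, rfl⟩ := natDegree_eq_zero.1 h0
      have ha : a ≠ 0 := by rintro rfl; exact hR.ne_zero (by simp)
      have h1 : (1 : ℝ) ≤ |(a : ℝ)| := by exact_mod_cast Int.one_le_abs ha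
      rw [natDegree_C, pow_zero, one_mul, aeval_C, eq_intCast]
      exact (Real.rpow_le_one_of_one_le_of_nonpos (one_le_intMahler hR.ne_zero)
        (neg_nonpos.2 hv.le)).trans h1
    · refine le_trans ?_ (h R hR h0 (by omega))
      exact mul_le_mul_of_nonneg_right (pow_le_of_le_one hδ0 hδ1 (by omega))
        (Real.rpow_nonneg (hM _) _)

/-- Otherwise every irreducible `R` satisfies `δ M(R)^(-v) ≤ |R(ζ)|`: those with `M(R) ≥ B` by
assumption, the others by Northcott finiteness. By multiplicativity `|P(ζ)| ≫ X^(-v)` for all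
nonzero `P` of height at most `X`, which contradicts `v < w`. -/
theorem exists_irreducible_small_value {ζ : ℝ} (hζ : Transcendental ℚ ζ) {n : ℕ} {v w : ℝ}
    (hv : 0 < v) (hvw : v < w)
    (h : ∀ᶠ X : ℝ in atTop, ∃ P : ℤ[X], P.natDegree ≤ n ∧ SolvesSystem ζ w X P) (B : ℝ) :
    ∃ R : ℤ[X], Irreducible R ∧ 1 ≤ R.natDegree ∧ R.natDegree ≤ n ∧ B ≤ intMahler R ∧
      |aeval ζ R| ≤ intMahler R ^ (-v) := by
  by_contra! hcon
  have hfin : {p : ℤ[X] | p.natDegree ≤ n ∧ intMahler p ≤ B.toNNReal}.Finite :=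
    finite_mahlerMeasure_le n B.toNNReal
  obtain ⟨δ, hδ0, hδ1, hδ⟩ : ∃ δ : ℝ, 0 < δ ∧ δ ≤ 1 ∧ ∀ R : ℤ[X], R ≠ 0 → R.natDegree ≤ n →
      intMahler R ≤ B.toNNReal → δ ≤ |aeval ζ R| := by
    have hfin' : (insert (1 : ℝ) ((fun R : ℤ[X] => |aeval ζ R|) ''
      ({p : ℤ[X] | p.natDegree ≤ n ∧ intMahler p ≤ B.toNNReal} \ {0}))).Finite :=
      ((hfin.subset Set.sdiff_subset).image _).insert _
    obtain ⟨δ, hδ, hmin⟩ := Set.exists_min_image _ id hfin' ⟨1, Set.mem_insert _ _⟩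
    refine ⟨δ, ?_, hmin 1 (Set.mem_insert _ _), fun R hR hdeg hM =>
      hmin _ (Set.mem_insert_of_mem _ ⟨R, ⟨⟨hdeg, hM⟩, hR⟩, rfl⟩)⟩
    rcases hδ with rfl | ⟨R, ⟨-, hR⟩, rfl⟩
    · exact one_pos
    · exact abs_pos.2 (aeval_ne_zero_of_transcendental hζ hR)
  have hlow := pow_mul_rpow_intMahler_le_abs_aeval (ζ := ζ) (n := n) hv hδ0.le hδ1 (by
    intro R hR h1 hn
    have hM := one_le_intMahler hR.ne_zero
    by_cases hB : B ≤ intMahler R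
    · refine le_trans ?_ (hcon R hR h1 hn hB).le
      exact mul_le_of_le_one_left (Real.rpow_nonneg (by linarith) _) hδ1
    · refine le_trans ?_ (hδ R hR.ne_zero hn ((not_le.1 hB).le.trans (Real.le_coe_toNNReal B)))
      exact mul_le_of_le_one_right hδ0.le
        (Real.rpow_le_one_of_one_le_of_nonpos hM (by linarith)))
  have ht := (tendsto_rpow_atTop (sub_pos.2 hvw)).eventually_gt_atTop
    (1 / (δ ^ n * ((n : ℝ) + 1) ^ (-v)))
  obtain ⟨X, ⟨P, hdeg, hH, h0, h1⟩, hX, hX1⟩ := (h.and (ht.and (eventually_gt_atTop 0))).exists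
  have hP : P ≠ 0 := by rintro rfl; simp at h0
  have hM := intMahler_le_supNorm hdeg
  have hM1 := one_le_intMahler hP
  have h2 := hlow P hP hdeg
  have h3 : δ ^ n * (((n : ℝ) + 1) ^ (-v) * X ^ (-v)) ≤ X ^ (-w) := by
    refine le_trans ?_ (h2.trans h1)
    rw [← Real.mul_rpow (by positivity) hX1.le]
    refine mul_le_mul (pow_le_pow_of_le_one hδ0.le hδ1 hdeg) ?_ (by positivity) (by positivity)
    refine Real.rpow_le_rpow_of_nonpos (by linarith) (hM.trans ?_) (by linarith)
    gcongr
  have h4 : 0 < δ ^ n * ((n : ℝ) + 1) ^ (-v) := by positivity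
  rw [div_lt_iff₀ h4] at hX
  have h5 := mul_le_mul_of_nonneg_right h3 (Real.rpow_nonneg hX1.le w)
  rw [← Real.rpow_add hX1, neg_add_cancel, Real.rpow_zero, ← mul_assoc, mul_assoc,
    ← Real.rpow_add hX1, neg_add_eq_sub] at h5
  linarith

/-! ### From irreducible combinations to approximation in exact degree -/

/-- Any irreducible `R` of positive degree less than `n` and any `P` of degree `n` not divisible
by `R` have a combination `A * R + B * P` with small coefficients `A`, `B` that has degree `n` and
is irreducible up to its content. -/
def HasIrreducibleCombinations (n : ℕ) : Prop :=
  ∀ ε : ℝ, 0 < ε → ∃ c : ℝ, ∀ R P : ℤ[X], Irreducible R → 1 ≤ R.natDegree → R.natDegree < n →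
    P.natDegree = n → ¬ R ∣ P → ∀ H : ℝ, 1 ≤ H → R.supNorm ≤ H → P.supNorm ≤ H →
    ∃ A B : ℤ[X], A.natDegree ≤ n ∧ B.natDegree ≤ n ∧ A.supNorm ≤ c * H ^ ε ∧
      B.supNorm ≤ c * H ^ ε ∧ (A * R + B * P).natDegree = n ∧ Irreducible (A * R + B * P).primPart

/-- A polynomial not divisible by `R` can be raised to degree `n` without changing its Mahler
measure. -/
theorem exists_natDegree_eq_not_dvd {R P : ℤ[X]} (hR : Irreducible R) (hRP : ¬ R ∣ P) {n : ℕ}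
    (hP : P.natDegree ≤ n) (ζ : ℝ) :
    ∃ Q : ℤ[X], Q.natDegree = n ∧ ¬ R ∣ Q ∧ intMahler Q = intMahler P ∧
      |aeval ζ Q| ≤ (1 + |ζ|) ^ n * |aeval ζ P| := by
  -- `R` cannot divide both `X` and `X - 1`, whose difference is a unit; both have Mahler measure 1.
  obtain ⟨j, hj, hdvd⟩ : ∃ j : ℤ, (j = 0 ∨ j = 1) ∧ ¬ R ∣ X - C j := by
    by_contra! h
    refine hR.not_isUnit (isUnit_of_dvd_one ?_)
    simpa using dvd_sub (h 0 (Or.inl rfl)) (h 1 (Or.inr rfl))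
  have hj1 : |(j : ℝ)| ≤ 1 := by rcases hj with rfl | rfl <;> simp
  have hM (k : ℕ) : intMahler ((X - C j) ^ k) = 1 := by
    induction k with
    | zero => simp [intMahler]
    | succ k ih =>
      rw [pow_succ, intMahler_mul, ih, one_mul, intMahler, Polynomial.map_sub, map_X, map_C,
        mahlerMeasure_X_sub_C]
      rcases hj with rfl | rfl <;> simp
  have hP0 : P ≠ 0 := by rintro rfl; exact hRP (dvd_zero R)
  refine ⟨P * (X - C j) ^ (n - P.natDegree), ?_, ?_, ?_, ?_⟩
  · rw [natDegree_mul hP0 (pow_ne_zero _ (X_sub_C_ne_zero j)), natDegree_pow, natDegree_X_sub_C]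
    omega
  · intro h
    rcases hR.prime.dvd_or_dvd h with h | h
    · exact hRP h
    · exact hdvd (hR.prime.dvd_of_dvd_pow h)
  · rw [intMahler_mul, hM, mul_one]
  · rw [map_mul, abs_mul, mul_comm, map_pow, abs_pow]
    refine mul_le_mul_of_nonneg_right ?_ (abs_nonneg _)
    have h1 : |aeval ζ (X - C j)| ≤ 1 + |ζ| := by
      rw [map_sub, aeval_X, aeval_C, eq_intCast]
      exact (abs_sub _ _).trans (by linarith)
    exact (pow_le_pow_left₀ (abs_nonneg _) h1 _).trans
      (pow_le_pow_right₀ (by linarith [abs_nonneg ζ]) (Nat.sub_le _ _))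

theorem eventually_mul_rpow_le {a b : ℝ} (hab : a < b) (C : ℝ) :
    ∀ᶠ H : ℝ in atTop, C * H ^ (-b) ≤ H ^ (-a) := by
  filter_upwards [(tendsto_rpow_atTop (sub_pos.2 hab)).eventually_ge_atTop C,
    eventually_gt_atTop 0] with H h1 h0
  calc C * H ^ (-b) ≤ H ^ (b - a) * H ^ (-b) := by gcongr
    _ = H ^ (-a) := by rw [← Real.rpow_add h0]; congr 1; ring

theorem frequently_exists_irreducible {ζ : ℝ} (hζ : Transcendental ℚ ζ) {n : ℕ}
    (hcomb : HasIrreducibleCombinations n) {v w : ℝ} (hv : 0 < v) (hvw : v < w)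
    (h : ∀ᶠ X : ℝ in atTop, ∃ P : ℤ[X], P.natDegree ≤ n ∧ SolvesSystem ζ w X P) :
    ∃ᶠ X : ℝ in atTop, ∃ P : ℤ[X], P.natDegree = n ∧ Irreducible P ∧ SolvesSystem ζ v X P := by
  obtain ⟨u, hvu, huw⟩ := exists_between hvw
  have hu : 0 < u := hv.trans hvu
  obtain ⟨ε, hε, hεu⟩ : ∃ ε : ℝ, 0 < ε ∧ (1 + ε) * v < u - ε := by
    -- This makes `ε(1 + v) = (u - v)/2`, half of the available room.
    refine ⟨(u - v) / (2 * (1 + v)), div_pos (by linarith) (by linarith), ?_⟩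
    have : (u - v) / (2 * (1 + v)) * (1 + v) = (u - v) / 2 := by field_simp
    nlinarith
  obtain ⟨c₀, hc₀⟩ := hcomb ε hε
  obtain ⟨c, hc1, hc⟩ : ∃ c : ℝ, 1 ≤ c ∧ c₀ ≤ c := ⟨max 1 c₀, le_max_left _ _, le_max_right _ _⟩
  -- With `H = 2^n M(R)`, height at most `H / K = M(R) / (2(n+1))` forces `M(P) ≤ M(R)/2`.
  set K : ℝ := 2 ^ n * (2 * (n + 1)) with hK
  have hn0 : (0 : ℝ) ≤ n := n.cast_nonneg
  have hK1 : 0 < K := by positivity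
  set S := ∑ i ∈ Finset.range (n + 1), |ζ| ^ i with hS
  have hS0 : 0 ≤ S := by positivity
  set D₁ : ℝ := 2 * (n + 1) * c with hD₁
  have hD₁1 : 1 ≤ D₁ := by nlinarith
  set L : ℝ := K ^ u * (1 + |ζ|) ^ n with hL
  have hL1 : K ^ u ≤ L :=
    le_mul_of_one_le_right (by positivity) (one_le_pow₀ (by linarith [abs_nonneg ζ]))
  have hL0 : 0 ≤ L := by positivity
  rw [frequently_atTop]
  intro X₀
  have hK' : Tendsto (fun H : ℝ => H / K) atTop atTop := tendsto_id.atTop_div_const hK1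
  -- The last condition serves the combination: value at most `2ScL H^(-(u-ε))`, to be compared with
  -- the `-v` power of the height bound `D₁ H^(1+ε)`.
  obtain ⟨B, hB⟩ := eventually_atTop.1 ((hK'.eventually h).and
    ((hK'.eventually_ge_atTop 1).and ((eventually_ge_atTop X₀).and ((eventually_ge_atTop 1).and
    ((eventually_mul_rpow_le hvu (K ^ u)).and
      (eventually_mul_rpow_le hεu (2 * S * c * L * D₁ ^ v)))))))
  obtain ⟨R, hR, hR1, hRn, hRB, hRζ⟩ := exists_irreducible_small_value hζ hu huw h B
  have hM1 := one_le_intMahler hR.ne_zero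
  set H : ℝ := 2 ^ n * intMahler R with hH
  have h2n : (1 : ℝ) ≤ 2 ^ n := one_le_pow₀ (by norm_num)
  obtain ⟨⟨P, hPn, hPH, hP0, hPζ⟩, hHK, hHX, hH1, hlast, hlast'⟩ := hB H (hRB.trans (by nlinarith))
  have hH0 : 0 < H := by linarith
  have hRH : R.supNorm ≤ H := supNorm_le_intMahler hRn
  have hKu : (H / K) ^ (-u) = K ^ u * H ^ (-u) := by
    rw [Real.div_rpow hH0.le hK1.le, Real.rpow_neg hK1.le, div_inv_eq_mul, mul_comm]
  have hHK' : H / K = intMahler R / (2 * (n + 1)) := by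
    rw [hH, hK, mul_div_mul_left _ _ (by positivity)]
  have hRu : |aeval ζ R| ≤ K ^ u * H ^ (-u) := by
    rw [← hKu]
    refine hRζ.trans (Real.rpow_le_rpow_of_nonpos (by linarith) ?_ (by linarith))
    rw [hHK']
    exact div_le_self (by linarith) (by linarith)
  have hPu : |aeval ζ P| ≤ K ^ u * H ^ (-u) := by
    rw [← hKu]
    exact hPζ.trans (Real.rpow_le_rpow_of_exponent_le hHK (by linarith))
  rcases hRn.eq_or_lt with hRn' | hRn'
  · exact ⟨H, hHX, R, hRn', hR, hRH, abs_pos.2 (aeval_ne_zero_of_transcendental hζ hR.ne_zero),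
      hRu.trans hlast⟩
  have hPne : P ≠ 0 := by rintro rfl; simp at hP0
  have hPM : intMahler P ≤ intMahler R / 2 := by
    refine (intMahler_le_supNorm hPn).trans ?_
    calc ((n : ℝ) + 1) * P.supNorm ≤ (n + 1) * (intMahler R / (2 * (n + 1))) := by
          rw [← hHK']; gcongr
      _ = intMahler R / 2 := by field_simp
  have hRP : ¬ R ∣ P := fun hd => by linarith [intMahler_le_of_dvd hd hPne]
  obtain ⟨Q, hQn, hRQ, hQM, hQζ⟩ := exists_natDegree_eq_not_dvd hR hRP hPn ζ
  have hQH : Q.supNorm ≤ H := (supNorm_le_intMahler hQn.le).trans (by rw [hQM, hH]; gcongr; linarith)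
  have hRL : |aeval ζ R| ≤ L * H ^ (-u) := hRu.trans (by gcongr)
  have hQL : |aeval ζ Q| ≤ L * H ^ (-u) := by
    refine hQζ.trans ?_
    rw [hL, mul_comm (K ^ u), mul_assoc]
    gcongr
  obtain ⟨A, B, hA, hB, hAH, hBH, hF, hFirr⟩ := hc₀ R Q hR hR1 hRn' hQn hRQ H hH1 hRH hQH
  replace hAH : A.supNorm ≤ c * H ^ ε := hAH.trans (by gcongr)
  replace hBH : B.supNorm ≤ c * H ^ ε := hBH.trans (by gcongr)
  set F := A * R + B * Q with hFdef
  have hF0 : F ≠ 0 := by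
    rintro h0
    rw [h0, natDegree_zero] at hF
    omega
  have hHε : H ^ (1 + ε) = H ^ ε * H := by rw [add_comm, Real.rpow_add hH0, Real.rpow_one]
  refine ⟨D₁ * H ^ (1 + ε), ?_, F.primPart, by rw [natDegree_primPart, hF], hFirr, ?_,
    abs_pos.2 (aeval_ne_zero_of_transcendental hζ hFirr.ne_zero), ?_⟩
  · calc X₀ ≤ H := hHX
      _ = 1 * H ^ (1 : ℝ) := by simp
      _ ≤ D₁ * H ^ (1 + ε) := by gcongr; linarith
  · refine (supNorm_primPart_le hF0).trans ((supNorm_add_le _ _).trans ?_)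
    have hprod : ∀ T U : ℤ[X], T.natDegree ≤ n → T.supNorm ≤ c * H ^ ε → U.supNorm ≤ H →
        (T * U).supNorm ≤ (n + 1) * (c * H ^ ε * H) := fun T U hT h1 h2 =>
      (supNorm_mul_le hT U).trans (by
        have := U.supNorm_nonneg
        gcongr)
    refine (add_le_add (hprod A R hA hAH hRH) (hprod B Q hB hBH hQH)).trans_eq ?_
    rw [hD₁, hHε]
    ring
  · refine (abs_aeval_primPart_le hF0 ζ).trans ?_
    have hprod : ∀ T U : ℤ[X], T.natDegree ≤ n → T.supNorm ≤ c * H ^ ε →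
        |aeval ζ U| ≤ L * H ^ (-u) →
        |aeval ζ (T * U)| ≤ S * (c * H ^ ε) * (L * H ^ (-u)) := fun T U hT h1 h2 => by
      rw [map_mul, abs_mul]
      exact mul_le_mul ((abs_aeval_le hT ζ).trans (by gcongr)) h2 (abs_nonneg _) (by positivity)
    have h1 : |aeval ζ F| ≤ 2 * S * c * L * H ^ (-(u - ε)) := by
      rw [hFdef, map_add]
      refine (abs_add_le _ _).trans
        ((add_le_add (hprod A R hA hAH hRL) (hprod B Q hB hBH hQL)).trans_eq ?_)
      rw [neg_sub, sub_eq_add_neg, Real.rpow_add hH0]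
      ring
    rw [Real.mul_rpow (by linarith) (by positivity), ← Real.rpow_mul hH0.le, Real.rpow_neg
      (by linarith : 0 ≤ D₁), inv_mul_eq_div, le_div_iff₀ (by positivity), mul_neg]
    refine le_trans (mul_le_mul_of_nonneg_right h1 (by positivity)) (le_trans (le_of_eq ?_) hlast')
    ring

theorem uniformExponent_le_exactExponent {ζ : ℝ} (hζ : Transcendental ℚ ζ) {n : ℕ} (hn : 1 ≤ n)
    (hcomb : HasIrreducibleCombinations n) : uniformExponent n ζ ≤ exactExponent n ζ := by
  refine le_of_forall_lt fun c hc => ?_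
  have h0 : ((0 : ℝ) : EReal) < uniformExponent n ζ :=
    lt_of_lt_of_le (by exact_mod_cast hn) (natCast_le_uniformExponent hζ n)
  -- Taking the maximum with `0 < n ≤ ŵ_n` keeps `v` positive.
  obtain ⟨v, hcv, hv⟩ := EReal.lt_iff_exists_real_btwn.1 (max_lt hc h0)
  obtain ⟨w, hvw, hw⟩ := EReal.lt_iff_exists_real_btwn.1 hv
  have hv0 : 0 < v := by exact_mod_cast (le_max_right _ _).trans_lt hcv
  refine ((le_max_left _ _).trans_lt hcv).trans_le (le_sSup ⟨v, rfl, ?_⟩)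
  exact frequently_exists_irreducible hζ hcomb hv0 (by exact_mod_cast hvw)
    (eventually_of_lt_uniformExponent hw)

theorem irreducible_primPart_of_irreducible_map {F : ℤ[X]}
    (hF : Irreducible (F.map (Int.castRingHom ℚ))) : Irreducible F.primPart := by
  have hF0 : F ≠ 0 := by rintro rfl; simp at hF
  rw [IsPrimitive.Int.irreducible_iff_irreducible_map_cast F.isPrimitive_primPart]
  rw [F.eq_C_content_mul_primPart, Polynomial.map_mul, map_C] at hF
  have hu : IsUnit (C (Int.castRingHom ℚ F.content)) := by
    rw [isUnit_C, isUnit_iff_ne_zero, eq_intCast]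
    exact_mod_cast mt content_eq_zero_iff.1 hF0
  exact (irreducible_isUnit_mul hu).1 hF

/-- Constants `A = a`, `B = b` suffice: since `deg R < n = deg P` and `b ≠ 0`, the degree is
automatically `n`. -/
theorem IrreducibilityCriterion.hasIrreducibleCombinations {n : ℕ}
    (h : IrreducibilityCriterion n) : HasIrreducibleCombinations n := by
  intro ε hε
  obtain ⟨c, hc⟩ := h ε hε
  refine ⟨|c|, fun R P hR hR1 hRn hP hRP H hH hRH hPH => ?_⟩
  obtain ⟨a, b, ha, hb, hab, hirr⟩ := hc R P hRn.le hP.le (Or.inl (by omega))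
    ((hR.isRelPrime_iff_not_dvd).2 hRP)
  have hmax : ((max |a| |b| : ℤ) : ℝ) ≤ |c| * H ^ ε := by
    refine hab.trans (mul_le_mul (le_abs_self c) ?_ ?_ (abs_nonneg c))
    · exact Real.rpow_le_rpow (le_max_of_le_left R.supNorm_nonneg) (max_le hRH hPH) hε.le
    · exact Real.rpow_nonneg (le_max_of_le_left R.supNorm_nonneg) _
  push_cast at hmax
  refine ⟨C a, C b, by simp, by simp, ?_, ?_, ?_, irreducible_primPart_of_irreducible_map hirr⟩
  · rw [supNorm_C, Int.norm_eq_abs]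
    exact (le_max_left _ _).trans hmax
  · rw [supNorm_C, Int.norm_eq_abs]
    exact (le_max_right _ _).trans hmax
  · rw [natDegree_add_eq_right_of_natDegree_lt, natDegree_C_mul hb, hP]
    rwa [natDegree_C_mul ha, natDegree_C_mul hb, hP]

/-! ### Irreducible cubics over a finite field -/

section FiniteField

variable {K : Type*} [Field K] [Fintype K] [DecidableEq K]

/-- If no affine function agrees with `t` in more than three points of `Z`, then some affine function
with slope different from `u₀` agrees with `t` nowhere on `Z`. -/
theorem exists_affine_ne_of_card_le_three (hK : 5 ≤ Fintype.card K) (Z : Finset K) (t : K → K)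
    (h3 : ∀ u v : K, (Z.filter fun x => u * x + v = t x).card ≤ 3) (u₀ : K) :
    ∃ u v : K, u ≠ u₀ ∧ ∀ x ∈ Z, u * x + v ≠ t x := by
  -- Let `k(l)` be the number of points of the graph over `Z` on the line `l`. If every slope other
  -- than `u₀` gives `1 ≤ k ≤ 3`, then `(k-1)(k-3) ≤ 0` off slope `u₀`; summing over all lines
  -- contradicts the second moment of `k` as soon as `q ≥ 5`.
  by_contra! hcon
  set q : ℤ := ((Fintype.card K : ℕ) : ℤ) with hq
  set m : ℤ := ((Z.card : ℕ) : ℤ) with hm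
  let I : K → K × K → ℤ := fun x l => if l.1 * x + l.2 = t x then 1 else 0
  let k : K × K → ℤ := fun l => ∑ x ∈ Z, I x l
  have hk (l : K × K) : k l = (Z.filter fun x => l.1 * x + l.2 = t x).card := by
    simp only [k, I, Finset.sum_boole]
  have hupper (l : K × K) : (k l - 1) * (k l - 3) ≤ if l.1 = u₀ then 3 else 0 := by
    have h := h3 l.1 l.2
    have hk0 : k l ≤ 3 := by rw [hk]; exact_mod_cast h
    have hk1 : 0 ≤ k l := by rw [hk]; positivity
    split_ifs with hl
    · nlinarith
    · obtain ⟨x, hx, hxt⟩ := hcon l.1 l.2 hl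
      have : 1 ≤ k l := by
        rw [hk]
        exact_mod_cast Finset.card_pos.2 ⟨x, Finset.mem_filter.2 ⟨hx, hxt⟩⟩
      nlinarith
  have hI (x : K) : ∑ l, I x l = q := by
    rw [Fintype.sum_prod_type]
    have (u : K) : ∑ v, I x (u, v) = 1 := by
      rw [Finset.sum_eq_single (t x - u * x)]
      · simp [I]
      · intro v _ hv
        refine if_neg fun h => hv ?_
        rw [← h]
        ring
      · simp
    simp [this, hq]
  -- A point lies on `q` lines, and two points with distinct abscissas share a line.
  have hII (x y : K) : (if x = y then q else 1) ≤ ∑ l, I x l * I y l := by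
    split_ifs with hxy
    · subst hxy
      rw [← hI x]
      exact Finset.sum_le_sum fun l _ => by simp only [I]; split_ifs <;> simp
    · have hs : x - y ≠ 0 := sub_ne_zero.2 hxy
      set l : K × K := ((t x - t y) / (x - y), t x - (t x - t y) / (x - y) * x) with hl
      have h1 : I x l = 1 := if_pos (by rw [hl]; ring)
      have h2 : I y l = 1 := if_pos (by rw [hl]; field_simp; ring)
      calc (1 : ℤ) = I x l * I y l := by rw [h1, h2, one_mul]
        _ ≤ ∑ l, I x l * I y l := Finset.single_le_sum (f := fun l => I x l * I y l)
          (fun l _ => by simp only [I]; split_ifs <;> simp) (Finset.mem_univ l)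
  have hS1 : ∑ l, k l = m * q := by
    simp only [k]
    rw [Finset.sum_comm]
    simp [hI, hm]
  have hS2 : m * q + m * (m - 1) ≤ ∑ l, k l * k l := by
    simp only [k, Finset.sum_mul_sum]
    rw [Finset.sum_comm]
    calc m * q + m * (m - 1) = ∑ x ∈ Z, ∑ y ∈ Z, (if x = y then q else 1) := by
          have : ∀ x ∈ Z, ∑ y ∈ Z, (if x = y then q else 1) = q + (m - 1) := fun x hx => by
            rw [← Finset.add_sum_erase _ _ hx, if_pos rfl,
              Finset.sum_congr rfl fun y hy => if_neg (Finset.ne_of_mem_erase hy).symm]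
            simp [Finset.card_erase_of_mem hx, hm, Nat.cast_sub (Finset.card_pos.2 ⟨x, hx⟩)]
          rw [Finset.sum_congr rfl this, Finset.sum_const, nsmul_eq_mul]
          ring
      _ ≤ _ := Finset.sum_le_sum fun x _ => by
          rw [Finset.sum_comm]
          exact Finset.sum_le_sum fun y _ => hII x y
  have hS3 : ∑ l, (k l - 1) * (k l - 3) ≤ 3 * q := by
    refine (Finset.sum_le_sum fun l _ => hupper l).trans_eq ?_
    rw [Fintype.sum_prod_type, Finset.sum_eq_single u₀]
    · simp [hq, mul_comm]
    · intro u _ hu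
      simp [hu]
    · simp
  have hS4 : ∑ l, (k l - 1) * (k l - 3) = ∑ l, k l * k l - 4 * ∑ l, k l + 3 * q ^ 2 := by
    rw [Finset.mul_sum, ← Finset.sum_sub_distrib]
    have : 3 * q ^ 2 = ∑ _l : K × K, (3 : ℤ) := by simp [hq]; ring
    rw [this, ← Finset.sum_add_distrib]
    exact Finset.sum_congr rfl fun l _ => by ring
  have hmq : m ≤ q := by
    rw [hm, hq]
    exact_mod_cast Finset.card_le_univ Z
  have hq5 : 5 ≤ q := by rw [hq]; exact_mod_cast hK
  have hm0 : 0 ≤ m := by positivity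
  -- The hint is `(q-m)(2q-m+1) ≥ 0`; with the moments it reduces everything to `q² - q ≤ 3q`.
  nlinarith [mul_nonneg (sub_nonneg.2 hmq) (show 0 ≤ 2 * q - m + 1 by linarith)]

/-- By coprimality `R` does not vanish at a root of `A * R + P`, so roots are the points where the
line `A` meets the graph of `-P/R`. There are at most three of them, as the degree is at most 3. The
excluded slope is the one that kills the cubic coefficient. -/
theorem exists_irreducible_cubic_of_quadratic (hK : 5 ≤ Fintype.card K) {R P : K[X]}
    (hR : R.natDegree = 2) (hP : P.natDegree ≤ 3) (hRP : IsCoprime R P) :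
    ∃ A : K[X], A.natDegree ≤ 1 ∧ (A * R + P).natDegree = 3 ∧ Irreducible (A * R + P) := by
  have hdeg (u v : K) : ((C u * X + C v) * R + P).natDegree ≤ 3 := by
    refine natDegree_add_le_of_degree_le (natDegree_mul_le.trans ?_) hP
    have := natDegree_linear_le (a := u) (b := v)
    omega
  have hcoeff (u v : K) : ((C u * X + C v) * R + P).coeff 3 = u * R.leadingCoeff + P.coeff 3 := by
    rw [coeff_add, add_mul, coeff_add, mul_assoc, coeff_C_mul, coeff_C_mul, coeff_X_mul,
      coeff_eq_zero_of_natDegree_lt (show R.natDegree < 3 by omega), leadingCoeff, hR]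
    ring
  have hne (u v : K) : (C u * X + C v) * R + P ≠ 0 := by
    intro h
    have hd : R ∣ P := ⟨-(C u * X + C v), by linear_combination h⟩
    have := natDegree_eq_zero_of_isUnit (hRP.isUnit_of_dvd' dvd_rfl hd)
    omega
  have hroot (u v x : K) : ((C u * X + C v) * R + P).IsRoot x ↔
      R.eval x ≠ 0 ∧ u * x + v = -P.eval x / R.eval x := by
    simp only [IsRoot.def, eval_add, eval_mul, eval_C, eval_X]
    constructor
    · intro h
      have hx : R.eval x ≠ 0 := by
        intro hx
        obtain ⟨a, b, hab⟩ := hRP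
        have h1 := congrArg (eval x) hab
        rw [hx, mul_zero, zero_add] at h
        simp [hx, h] at h1
      refine ⟨hx, ?_⟩
      rw [eq_div_iff hx]
      linear_combination h
    · rintro ⟨hx, h⟩
      rw [eq_div_iff hx] at h
      linear_combination h
  have hlc : R.leadingCoeff ≠ 0 := leadingCoeff_ne_zero.2 (by rintro rfl; simp at hR)
  obtain ⟨u, v, hu, huv⟩ := exists_affine_ne_of_card_le_three hK
    (Finset.univ.filter fun x => R.eval x ≠ 0) (fun x => -P.eval x / R.eval x) (fun u v => by
      refine le_trans ?_ ((card_roots' ((C u * X + C v) * R + P)).trans (hdeg u v))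
      refine le_trans (Finset.card_le_card fun x hx => ?_) (Multiset.toFinset_card_le _)
      simp only [Finset.mem_filter, Finset.mem_univ, true_and] at hx
      rw [Multiset.mem_toFinset, mem_roots (hne u v), hroot]
      exact hx) (-P.coeff 3 / R.leadingCoeff)
  have hdeg3 : ((C u * X + C v) * R + P).natDegree = 3 := by
    refine natDegree_eq_of_le_of_coeff_ne_zero (hdeg u v) ?_
    rw [hcoeff]
    intro h
    exact hu (by rw [eq_div_iff hlc]; linear_combination h)
  refine ⟨C u * X + C v, natDegree_linear_le, hdeg3,
    irreducible_of_degree_le_three_of_not_isRoot (by simp [hdeg3]) fun x hx => ?_⟩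
  rw [hroot] at hx
  exact huv x (by simpa using hx.1) hx.2

theorem exists_irreducible_cubic (hK : 5 ≤ Fintype.card K) {R P : K[X]}
    (hR1 : 1 ≤ R.natDegree) (hR2 : R.natDegree ≤ 2) (hP : P.natDegree ≤ 3) (hRP : IsCoprime R P) :
    ∃ A : K[X], A.natDegree + R.natDegree ≤ 3 ∧ (A * R + P).natDegree = 3 ∧ Irreducible (A * R + P) := by
  rcases hR2.eq_or_lt with hR2 | hR2
  · obtain ⟨A, hA, h⟩ := exists_irreducible_cubic_of_quadratic hK hR2 hP hRP
    exact ⟨A, by omega, h⟩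
  have hR : R.natDegree = 1 := by omega
  have hP0 : P ≠ 0 := by
    rintro rfl
    have := natDegree_eq_zero_of_isUnit (isCoprime_zero_right.1 hRP)
    omega
  -- Multiplying a linear `R` by `X - C j` reduces to the quadratic case; `P(j) ≠ 0` preserves
  -- coprimality.
  obtain ⟨j, hj⟩ : ∃ j : K, P.eval j ≠ 0 := by
    by_contra! h
    refine hP0 (eq_zero_of_natDegree_lt_card_of_eval_eq_zero P Function.injective_id h ?_)
    omega
  have hR0 : R ≠ 0 := by rintro rfl; simp at hR
  obtain ⟨A, hA, h⟩ := exists_irreducible_cubic_of_quadratic hK (R := (X - C j) * R) (P := P)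
    (by rw [natDegree_mul (X_sub_C_ne_zero j) hR0, natDegree_X_sub_C, hR]) hP
    (IsCoprime.mul_left (((irreducible_X_sub_C j).coprime_iff_not_dvd).2 (by
      rwa [dvd_iff_isRoot])) hRP)
  rw [← mul_assoc] at h
  have hAj := natDegree_mul_le (p := A) (q := X - C j)
  rw [natDegree_X_sub_C] at hAj
  exact ⟨A * (X - C j), by omega, h⟩

end FiniteField

/-! ### Small primes not dividing a given integer -/

/-- Bertrand's postulate, iterated. -/
theorem exists_finset_primes (m N : ℕ) (hN : 1 ≤ N) :
    ∃ s : Finset ℕ, s.card = m ∧ ∀ p ∈ s, p.Prime ∧ N < p ∧ p ≤ 2 ^ m * N := by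
  induction m generalizing N with
  | zero => exact ⟨∅, by simp⟩
  | succ m ih =>
    obtain ⟨p, hp, hNp, hp2⟩ := Nat.exists_prime_lt_and_le_two_mul N (by omega)
    obtain ⟨s, hs, h⟩ := ih p hp.one_lt.le
    refine ⟨insert p s, ?_, fun r hr => ?_⟩
    · rw [Finset.card_insert_of_notMem fun hps => lt_irrefl _ (h p hps).2.1, hs]
    · rcases Finset.mem_insert.1 hr with rfl | hr
      · refine ⟨hp, hNp, hp2.trans ?_⟩
        rw [pow_succ, mul_assoc]
        exact Nat.le_mul_of_pos_left _ (by positivity)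
      · obtain ⟨h1, h2, h3⟩ := h r hr
        refine ⟨h1, hNp.trans h2, h3.trans ?_⟩
        rw [pow_succ, mul_assoc]
        gcongr

/-- Choose `m > k/ε` primes between `Z = (C+5) H^ε` and a constant multiple of `Z`. If all divided
`D`, their product would give `|D| ≥ Z^m > C H^k`. -/
theorem exists_small_prime_not_dvd (C : ℝ) (hC : 0 ≤ C) (k : ℕ) {ε : ℝ} (hε : 0 < ε) :
    ∃ c : ℝ, ∀ H : ℝ, 1 ≤ H → ∀ D : ℤ, D ≠ 0 → |(D : ℝ)| ≤ C * H ^ k →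
      ∃ p : ℕ, p.Prime ∧ 5 ≤ p ∧ ¬ (p : ℤ) ∣ D ∧ (p : ℝ) ≤ c * H ^ ε := by
  obtain ⟨m, hm⟩ := exists_nat_gt (k / ε)
  have hm0 : m ≠ 0 := by
    rintro rfl
    have : 0 ≤ (k : ℝ) / ε := by positivity
    simp only [Nat.cast_zero] at hm
    linarith
  rw [div_lt_iff₀ hε] at hm
  refine ⟨2 ^ m * (2 * (C + 5)), fun H hH D hD hDH => ?_⟩
  have hHε : 1 ≤ H ^ ε := Real.one_le_rpow hH hε.le
  set Z : ℝ := (C + 5) * H ^ ε with hZ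
  have hZ5 : C + 5 ≤ Z := le_mul_of_one_le_right (by linarith) hHε
  have hZN := Nat.le_ceil Z
  have hN5 : 5 ≤ ⌈Z⌉₊ := by
    have : (5 : ℝ) ≤ ⌈Z⌉₊ := by linarith
    exact_mod_cast this
  obtain ⟨s, hs, h⟩ := exists_finset_primes m ⌈Z⌉₊ (by omega)
  obtain ⟨p, hps, hpD⟩ : ∃ p ∈ s, ¬ (p : ℤ) ∣ D := by
    by_contra! hdvd
    have h1 : ∏ p ∈ s, p ∣ D.natAbs := Finset.prod_primes_dvd _
      (fun p hp => (h p hp).1.prime) fun p hp => Int.natCast_dvd.1 (hdvd p hp)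
    have h2 : ⌈Z⌉₊ ^ m ≤ D.natAbs := by
      rw [← hs]
      exact (Finset.pow_card_le_prod s id _ fun p hp => (h p hp).2.1.le).trans
        (Nat.le_of_dvd (Int.natAbs_pos.2 hD) h1)
    have h3 : (⌈Z⌉₊ : ℝ) ^ m ≤ |(D : ℝ)| := by
      rw [← Int.cast_abs, Int.abs_eq_natAbs]
      exact_mod_cast h2
    have h4 : C * H ^ k < (⌈Z⌉₊ : ℝ) ^ m := by
      calc C * H ^ k < (C + 5) * H ^ k := by gcongr; linarith
        _ ≤ (C + 5) ^ m * (H ^ ε) ^ m := by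
          gcongr
          · exact le_self_pow₀ (by linarith) hm0
          · rw [← Real.rpow_natCast, ← Real.rpow_natCast, ← Real.rpow_mul (by linarith)]
            exact Real.rpow_le_rpow_of_exponent_le hH (by linarith)
        _ = Z ^ m := by rw [hZ, mul_pow]
        _ ≤ _ := by gcongr
    linarith
  obtain ⟨hp, hNp, hp2⟩ := h p hps
  refine ⟨p, hp, by omega, hpD, ?_⟩
  have hceil := Nat.ceil_lt_add_one (show 0 ≤ Z by linarith)
  calc (p : ℝ) ≤ 2 ^ m * ⌈Z⌉₊ := by exact_mod_cast hp2
    _ ≤ 2 ^ m * (2 * Z) := by gcongr; linarith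
    _ = _ := by rw [hZ]; ring

/-! ### Reduction modulo a prime -/

/-- Gauss's lemma: `R` is primitive, so a rational quotient `P / R` has integer coefficients. -/
theorem isCoprime_map_rat {R P : ℤ[X]} (hR : Irreducible R) (hR1 : 1 ≤ R.natDegree)
    (hRP : ¬ R ∣ P) :
    IsCoprime (R.map (Int.castRingHom ℚ)) (P.map (Int.castRingHom ℚ)) := by
  have hprim : R.IsPrimitive := hR.isPrimitive (by omega)
  refine ((IsPrimitive.Int.irreducible_iff_irreducible_map_cast hprim).1
    hR).coprime_iff_not_dvd.2 fun ⟨g, hg⟩ => hRP ?_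
  have h : R.map (algebraMap ℤ ℚ) * g ∈ lifts (algebraMap ℤ ℚ) := ⟨P, hg⟩
  obtain ⟨S, hS⟩ := hprim.map_mul_mem_lifts_iff.1 h
  refine ⟨S, map_injective _ (Int.castRingHom ℚ).injective_int ?_⟩
  rw [hg, Polynomial.map_mul, ← hS]
  rfl

theorem resultant_ne_zero_of_not_dvd {R P : ℤ[X]} (hR : Irreducible R) (hR1 : 1 ≤ R.natDegree)
    (hRP : ¬ R ∣ P) : resultant R P ≠ 0 := by
  have h := resultant_ne_zero _ _ (isCoprime_map_rat hR hR1 hRP)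
  rw [natDegree_map_eq_of_injective (Int.castRingHom ℚ).injective_int,
    natDegree_map_eq_of_injective (Int.castRingHom ℚ).injective_int, resultant_map_map] at h
  exact fun h0 => h (by rw [h0, map_zero])

theorem abs_resultant_le (R P : ℤ[X]) (m n : ℕ) {H : ℝ} (hH : 0 ≤ H) (hR : R.supNorm ≤ H)
    (hP : P.supNorm ≤ H) : |((resultant R P m n : ℤ) : ℝ)| ≤ (m + n).factorial * H ^ (m + n) := by
  have hco (Q : ℤ[X]) (hQ : Q.supNorm ≤ H) (i : ℕ) : |Q.coeff i| ≤ ⌊H⌋ := by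
    rw [Int.le_floor]
    exact_mod_cast supNorm_le_iff.1 hQ i
  have h0 : 0 ≤ ⌊H⌋ := Int.floor_nonneg.2 hH
  have h := Matrix.det_le (A := sylvester R P m n) (abv := AbsoluteValue.abs) (x := ⌊H⌋) (by
    intro i j
    rw [AbsoluteValue.abs_apply]
    induction j using Fin.addCases with
    | left j =>
      simp only [sylvester, Matrix.of_apply, Fin.addCases_left]
      split_ifs
      · exact hco P hP _
      · simpa using h0
    | right j =>
      simp only [sylvester, Matrix.of_apply, Fin.addCases_right]
      split_ifs
      · exact hco R hR _
      · simpa using h0)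
  rw [AbsoluteValue.abs_apply, Fintype.card_fin, nsmul_eq_mul] at h
  calc |((resultant R P m n : ℤ) : ℝ)| ≤ (m + n).factorial * (⌊H⌋ : ℝ) ^ (m + n) := by
        exact_mod_cast h
    _ ≤ _ := by
        have : (0 : ℝ) ≤ ⌊H⌋ := by exact_mod_cast h0
        gcongr
        exact Int.floor_le H

/-- Reduce the Bézout identity `U R + V P = Res(R, P)` modulo `p`; its right side becomes a unit. -/
theorem isCoprime_map_zmod {R P : ℤ[X]} (hR1 : 1 ≤ R.natDegree) (p : ℕ) [Fact p.Prime]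
    (hp : ¬ (p : ℤ) ∣ resultant R P) :
    IsCoprime (R.map (Int.castRingHom (ZMod p))) (P.map (Int.castRingHom (ZMod p))) := by
  obtain ⟨U, V, -, -, h⟩ :=
    exists_mul_add_mul_eq_C_resultant R P le_rfl le_rfl (Or.inl (by omega))
  have h1 := congrArg (Polynomial.map (Int.castRingHom (ZMod p))) h
  rw [Polynomial.map_add, Polynomial.map_mul, Polynomial.map_mul, map_C, eq_intCast] at h1
  set a : ZMod p := ((resultant R P : ℤ) : ZMod p) with ha
  have ha0 : a ≠ 0 := by rwa [ha, Ne, ZMod.intCast_zmod_eq_zero_iff_dvd]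
  have ha1 : C a⁻¹ * C a = 1 := by rw [← C_mul, inv_mul_cancel₀ ha0, C_1]
  exact ⟨C a⁻¹ * U.map _, C a⁻¹ * V.map _, by linear_combination C a⁻¹ * h1 + ha1⟩

theorem exists_lift_zmod (p : ℕ) [NeZero p] (A : (ZMod p)[X]) {n : ℕ} (hA : A.natDegree ≤ n) :
    ∃ B : ℤ[X], B.map (Int.castRingHom (ZMod p)) = A ∧ B.natDegree ≤ n ∧ B.supNorm ≤ p := by
  have hco (i : ℕ) : (∑ j ∈ Finset.range (n + 1), monomial j (((A.coeff j).val : ℕ) : ℤ)).coeff i =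
      (A.coeff i).val := by
    rw [finsetSum_coeff]
    simp only [coeff_monomial, Finset.sum_ite_eq', Finset.mem_range]
    split_ifs with h
    · rfl
    · rw [coeff_eq_zero_of_natDegree_lt (by omega)]
      simp
  refine ⟨∑ j ∈ Finset.range (n + 1), monomial j (((A.coeff j).val : ℕ) : ℤ), ?_, ?_, ?_⟩
  · ext i
    rw [coeff_map, hco]
    simp
  · exact natDegree_sum_le_of_forall_le _ _ fun j hj =>
      (natDegree_monomial_le _).trans (by simp at hj; omega)
  · rw [supNorm_le_iff]
    intro i
    rw [hco, Int.cast_natCast, Nat.abs_cast]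
    exact_mod_cast (ZMod.val_lt _).le

/-- Since the degree is preserved, a factor that becomes a unit modulo `p` was already constant, and
a constant dividing a primitive polynomial is a unit. -/
theorem irreducible_primPart_of_irreducible_map_zmod {F : ℤ[X]} {p : ℕ} [Fact p.Prime]
    (hdeg : (F.map (Int.castRingHom (ZMod p))).natDegree = F.natDegree)
    (hF : Irreducible (F.map (Int.castRingHom (ZMod p)))) : Irreducible F.primPart := by
  set φ := Int.castRingHom (ZMod p) with hφ
  have hpos : 0 < F.natDegree := by
    rw [← hdeg]
    exact hF.natDegree_pos
  have hF0 : F.primPart ≠ 0 := primPart_ne_zero _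
  have key (a b : ℤ[X]) (hab : F.primPart = a * b) (hu : IsUnit (a.map φ)) (hb : (b.map φ) ≠ 0)
      (hd : (a * b).natDegree ≤ (b.map φ).natDegree) : IsUnit a := by
    rw [hab] at hF0
    rw [natDegree_mul (left_ne_zero_of_mul hF0) (right_ne_zero_of_mul hF0)] at hd
    have h1 := natDegree_map_le (f := φ) (p := b)
    obtain ⟨z, rfl⟩ := natDegree_eq_zero.1 (show a.natDegree = 0 by omega)
    exact isUnit_C.2 (F.isPrimitive_primPart z (hab ▸ dvd_mul_right _ _))
  have hmap (a b : ℤ[X]) (hab : F.primPart = a * b) :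
      F.map φ = C (φ F.content) * (a.map φ * b.map φ) := by
    conv_lhs => rw [F.eq_C_content_mul_primPart, hab]
    simp
  have hc (a b : ℤ[X]) (hab : F.primPart = a * b) : C (φ F.content) ≠ 0 ∧ a.map φ ≠ 0 ∧
      b.map φ ≠ 0 ∧ (a.map φ).natDegree + (b.map φ).natDegree = (a * b).natDegree := by
    have h1 := hF.ne_zero
    rw [hmap a b hab] at h1
    have h2 := left_ne_zero_of_mul (right_ne_zero_of_mul h1)
    have h3 := right_ne_zero_of_mul (right_ne_zero_of_mul h1)
    refine ⟨left_ne_zero_of_mul h1, h2, h3, ?_⟩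
    rw [← natDegree_mul h2 h3, ← hab, natDegree_primPart, ← hdeg, hmap a b hab,
      natDegree_C_mul (C_ne_zero.1 (left_ne_zero_of_mul h1))]
  refine ⟨fun hu => ?_, fun a b hab => ?_⟩
  · have := natDegree_eq_zero_of_isUnit hu
    rw [natDegree_primPart] at this
    omega
  · obtain ⟨h0, ha, hb, hsum⟩ := hc a b hab
    have hcu : IsUnit (C (φ F.content)) := isUnit_C.2 (isUnit_iff_ne_zero.2 (C_ne_zero.1 h0))
    have hirr : Irreducible (a.map φ * b.map φ) := by
      rw [hmap a b hab] at hF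
      exact (irreducible_isUnit_mul hcu).1 hF
    rcases hirr.isUnit_or_isUnit rfl with h | h
    · have := natDegree_eq_zero_of_isUnit h
      exact Or.inl (key a b hab h hb (by omega))
    · have := natDegree_eq_zero_of_isUnit h
      exact Or.inr (key b a (hab.trans (mul_comm a b)) h ha (by rw [mul_comm b a]; omega))

/-! ### Irreducible combinations in degree three -/

theorem hasIrreducibleCombinations_three : HasIrreducibleCombinations 3 := by
  intro ε hε
  -- The resultant has a Sylvester matrix of size at most `2 + 3`, hence is at most `5! H^5`. The
  -- extra `H` is the leading coefficient of `R`, kept nonzero modulo `p`.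
  obtain ⟨c, hc⟩ := exists_small_prime_not_dvd 120 (by norm_num) 6 hε
  -- The 1 accommodates the coefficient `B = 1`.
  refine ⟨max c 1, fun R P hR hR1 hR3 hP hRP H hH hRH hPH => ?_⟩
  have hres := resultant_ne_zero_of_not_dvd hR hR1 hRP
  have hlc : R.leadingCoeff ≠ 0 := leadingCoeff_ne_zero.2 hR.ne_zero
  have hbound : |((R.leadingCoeff * resultant R P : ℤ) : ℝ)| ≤ 120 * H ^ 6 := by
    push_cast
    rw [abs_mul]
    calc |(R.leadingCoeff : ℝ)| * |((resultant R P : ℤ) : ℝ)|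
        ≤ H * ((R.natDegree + P.natDegree).factorial * H ^ (R.natDegree + P.natDegree)) :=
          mul_le_mul (supNorm_le_iff.1 hRH _) (abs_resultant_le R P _ _ (by linarith) hRH hPH)
            (abs_nonneg _) (by linarith)
      _ ≤ H * (120 * H ^ 5) := by
          have h1 : (R.natDegree + P.natDegree).factorial ≤ Nat.factorial 5 :=
            Nat.factorial_le (by omega)
          have h2 : ((R.natDegree + P.natDegree).factorial : ℝ) ≤ 120 := by exact_mod_cast h1
          have h3 : H ^ (R.natDegree + P.natDegree) ≤ H ^ 5 := pow_le_pow_right₀ hH (by omega)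
          gcongr
      _ = 120 * H ^ 6 := by ring
  obtain ⟨p, hp, hp5, hpD, hpH⟩ := hc H hH _ (mul_ne_zero hlc hres) hbound
  have : Fact p.Prime := ⟨hp⟩
  set φ := Int.castRingHom (ZMod p) with hφ
  have hRdeg : (R.map φ).natDegree = R.natDegree := by
    refine natDegree_map_of_leadingCoeff_ne_zero φ ?_
    rw [hφ, eq_intCast, Ne, ZMod.intCast_zmod_eq_zero_iff_dvd]
    exact fun h => hpD (h.mul_right _)
  obtain ⟨A₀, hA₀, hdeg, hirr⟩ := exists_irreducible_cubic (by rwa [ZMod.card])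
    (by rwa [hRdeg]) (by rw [hRdeg]; omega) (natDegree_map_le.trans hP.le)
    (isCoprime_map_zmod hR1 p fun h => hpD (h.mul_left _))
  obtain ⟨A, rfl, hA, hAp⟩ := exists_lift_zmod p A₀ (n := 3 - R.natDegree)
    (by rw [hRdeg] at hA₀; omega)
  have hmap : (A * R + 1 * P).map φ = A.map φ * R.map φ + P.map φ := by simp
  have hF : (A * R + 1 * P).natDegree = 3 := by
    refine le_antisymm ?_ ?_
    · rw [one_mul]
      exact natDegree_add_le_of_degree_le (natDegree_mul_le.trans (by omega)) hP.le
    · rw [← hdeg, ← hmap]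
      exact natDegree_map_le
  have hHε : 1 ≤ H ^ ε := Real.one_le_rpow hH hε.le
  refine ⟨A, 1, by omega, by simp, hAp.trans (hpH.trans ?_), ?_, hF,
    irreducible_primPart_of_irreducible_map_zmod (p := p) ?_ ?_⟩
  · gcongr
    exact le_max_left _ _
  · rw [← C_1, supNorm_C, norm_one]
    nlinarith [le_max_right c 1]
  · rw [hF, hmap, hdeg]
  · rwa [hmap]

theorem mainTheorem4 (ζ : ℝ) (hζ : Transcendental ℚ ζ) :
    (uniformExponent 3 ζ ≤ exactExponent 3 ζ ∧ 3 ≤ uniformExponent 3 ζ) ∧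
    ∀ n : ℕ, 4 ≤ n → IrreducibilityCriterion n →
      uniformExponent n ζ ≤ exactExponent n ζ ∧ (n : EReal) ≤ uniformExponent n ζ := by
  refine ⟨⟨uniformExponent_le_exactExponent hζ (by norm_num) hasIrreducibleCombinations_three,
    by exact_mod_cast natCast_le_uniformExponent hζ 3⟩, fun n hn hcrit =>
    ⟨uniformExponent_le_exactExponent hζ (by omega) hcrit.hasIrreducibleCombinations,
      natCast_le_uniformExponent hζ n⟩⟩
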